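/- Let $T$ be a commutative ring. A value map on $T$ is a map $v:T\to\mathbb R\cup\{\infty\}$ with $v(ab)=v(a)+v(b)$, $v(a+b)\ge\min\{v(a),v(b)\}$ and $v(0)=\infty$. Given a value map $v$, a $T$-module $M$ is called almost zero if for every $m\in M$ and every $\epsilon>0$ there is $b\in T$ with $bm=0$ and $v(b)<\epsilon$. A $T$-linear map is an almost isomorphism if its kernel and its cokernel are almost zero, and for $T$-modules $M,N$ one writes $M\approx N$ if there are a $T$-module $L$ and almost isomorphisms $L\to M$ and $L\to N$. Let $(R,\mathfrak m)$ be a Noetherian local ring of dimension $d$ and $T$ a commutative $R$-algebra with a value map $v$. For a $T$-module $M$, let $H^i_{\mathfrak m}(M)$ be the $i$-th cohomology module of the Čech complex of $M$ with respect to $x_1,\dots,x_r$, where $x_1,\dots,x_r\in R$ is any fixed finite sequence with $\sqrt{(x_1,\dots,x_r)}=\mathfrak m$ (for example a generating sequence of $\mathfrak m$, or a system of parameters of $R$); it is a $T$-module, and it is zero for $i<0$. Suppose that $T$ is almost Cohen–Macaulay over $R$, that is, $H^i_{\mathfrak m}(T)$ is almost zero for all $i\neq d$, and $T/\mathfrak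 mT$ is not almost zero. Then for every $T$-module $M$ and every $n\ge 0$, $$\operatorname{Tor}^T_n\bigl(H^d_{\mathfrak m}(T),M\bigr)\approx H^{d-n}_{\mathfrak m}(M).$$ In particular, $H^d_{\mathfrak m}(T)$ is not almost zero. -/

import Mathlib

universe u

/-- A value map on a commutative ring `T`: a map `v : T → ℝ ∪ {∞}` with `v (a * b) = v a + v b`,
`v (a + b) ≥ min (v a) (v b)` and `v 0 = ∞`.  It may take negative values, and `v a = ∞` is allowed
for `a ≠ 0`. -/
structure ValueMap (T : Type*) [CommRing T] where
  toFun : T → WithTop ℝ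
  map_mul' : ∀ a b, toFun (a * b) = toFun a + toFun b
  map_add' : ∀ a b, min (toFun a) (toFun b) ≤ toFun (a + b)
  map_zero' : toFun 0 = ⊤

instance {T : Type*} [CommRing T] : CoeFun (ValueMap T) (fun _ => T → WithTop ℝ) :=
  ⟨ValueMap.toFun⟩

section AlmostZero

variable {T : Type*} [CommRing T] (v : ValueMap T)

/-- `M` is almost zero with respect to `v`: every element of `M` is killed by elements of `T` of
value below any given `ε > 0`. -/
def IsAlmostZero (M : Type*) [AddCommGroup M] [Module T M] : Prop :=
  ∀ (m : M) (ε : ℝ), 0 < ε → ∃ b : T, b • m = 0 ∧ v b < (ε : WithTop ℝ)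

/-- A `T`-linear map is an almost isomorphism if its kernel and cokernel are almost zero. -/
def IsAlmostIso {M N : Type*} [AddCommGroup M] [Module T M] [AddCommGroup N] [Module T N]
    (f : M →ₗ[T] N) : Prop :=
  IsAlmostZero v (LinearMap.ker f) ∧ IsAlmostZero v (N ⧸ LinearMap.range f)

end AlmostZero

/-- `M ≈ N` (`M` and `N` are in the same almost isomorphic class): there is a `T`-module `L` with
almost isomorphisms `L → M` and `L → N`. -/
def SameAlmostIsoClass {T : Type u} [CommRing T] (v : ValueMap T) (M N : ModuleCat.{u} T) : Prop :=
  ∃ (L : ModuleCat.{u} T) (f : L →ₗ[T] M) (g : L →ₗ[T] N), IsAlmostIso v f ∧ IsAlmostIso v g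

section Cech

variable {T : Type*} [CommRing T] {r : ℕ} (x : Fin r → T) (M : Type*) [AddCommGroup M] [Module T M]

/-- The localization `M_{x_S}` of `M` at the powers of `x_S = ∏_{j ∈ S} x_j`. -/
abbrev CechLoc (S : Finset (Fin r)) : Type _ :=
  LocalizedModule (Submonoid.powers (∏ j ∈ S, x j)) M

lemma cechLoc_isUnit {U S : Finset (Fin r)} (h : U ⊆ S)
    (a : Submonoid.powers (∏ j ∈ U, x j)) :
    IsUnit (algebraMap T (Module.End T (CechLoc x M S)) a) := by
  obtain ⟨_, n, rfl⟩ := a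
  have hS := IsLocalizedModule.map_units
    (LocalizedModule.mkLinearMap (Submonoid.powers (∏ j ∈ S, x j)) M)
    ⟨∏ j ∈ S, x j, Submonoid.mem_powers _⟩
  obtain ⟨c, hc⟩ := Finset.prod_dvd_prod_of_subset U S x h
  simp only [hc, map_mul] at hS
  have hU := ((Commute.isUnit_mul_iff (Algebra.commute_algebraMap_left (∏ j ∈ U, x j)
    (algebraMap T (Module.End T (CechLoc x M S)) c))).mp hS).1
  simpa using hU.pow n

/-- The canonical map `M_{x_U} → M_{x_S}` for `U ⊆ S`. -/
noncomputable def cechRes {U S : Finset (Fin r)} (h : U ⊆ S) :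
    CechLoc x M U →ₗ[T] CechLoc x M S :=
  LocalizedModule.lift (Submonoid.powers (∏ j ∈ U, x j))
    (LocalizedModule.mkLinearMap (Submonoid.powers (∏ j ∈ S, x j)) M) (cechLoc_isUnit x M h)

lemma cechRes_comp {U S W : Finset (Fin r)} (h : U ⊆ S) (h' : S ⊆ W) :
    (cechRes x M h').comp (cechRes x M h) = cechRes x M (h.trans h') := by
  refine (LocalizedModule.lift_unique _ _ (cechLoc_isUnit x M (h.trans h')) _ ?_).symm
  rw [LinearMap.comp_assoc, cechRes, cechRes, LocalizedModule.lift_comp,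
    LocalizedModule.lift_comp]

/-- The degree `i` term of the Čech complex: the (finite) direct sum of the `M_{x_S}` over the
subsets `S` of `{1, …, r}` with `i` elements.  It is zero unless `0 ≤ i ≤ r`. -/
abbrev CechTerm (i : ℤ) : Type _ :=
  (S : {S : Finset (Fin r) // (S.card : ℤ) = i}) → CechLoc x M S.1

lemma card_erase_eq {i j : ℤ} (h : i + 1 = j) {S : Finset (Fin r)} (hS : (S.card : ℤ) = j)
    {a : Fin r} (ha : a ∈ S) : ((S.erase a).card : ℤ) = i := by
  have := Finset.card_erase_add_one ha
  omega

/-- The Čech differential: the component of `d f` at `S = {j_0 < j_1 < ⋯}` is the alternating sum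
`∑_k (-1)^k f(S \ {j_k})`, each summand being mapped to `M_{x_S}`. -/
noncomputable def cechD {i j : ℤ} (h : i + 1 = j) : CechTerm x M i →ₗ[T] CechTerm x M j :=
  LinearMap.pi fun S => ∑ a : {a // a ∈ S.1},
    ((-1 : T) ^ (S.1.filter (· < a.1)).card) •
      (cechRes x M (Finset.erase_subset a.1 S.1)).comp
        (LinearMap.proj (R := T)
          (φ := fun S : {S : Finset (Fin r) // (S.card : ℤ) = i} => CechLoc x M S.1)
          ⟨S.1.erase a.1, card_erase_eq h S.2 a.2⟩)

lemma cechD_apply {i j : ℤ} (h : i + 1 = j) (f : CechTerm x M i)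
    (S : {S : Finset (Fin r) // (S.card : ℤ) = j}) :
    cechD x M h f S = ∑ a : {a // a ∈ S.1},
    ((-1 : T) ^ (S.1.filter (· < a.1)).card) •
      cechRes x M (Finset.erase_subset a.1 S.1)
        (f ⟨S.1.erase a.1, card_erase_eq h S.2 a.2⟩) := by
  simp [cechD]

lemma cech_sign (T : Type*) [CommRing T] {r : ℕ} (S : Finset (Fin r)) {a b : Fin r} (ha : a ∈ S) (hab : a < b) :
    ((-1 : T) ^ (S.filter (· < a)).card) * (-1) ^ ((S.erase a).filter (· < b)).card
      + ((-1 : T) ^ (S.filter (· < b)).card) * (-1) ^ ((S.erase b).filter (· < a)).card = 0 := by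
  have h1 : (S.erase b).filter (· < a) = S.filter (· < a) := by
    ext c; simp only [Finset.mem_filter, Finset.mem_erase]
    constructor
    · rintro ⟨⟨-, h⟩, h'⟩; exact ⟨h, h'⟩
    · rintro ⟨h, h'⟩; exact ⟨⟨(h'.trans hab).ne, h⟩, h'⟩
  have h2 : (S.erase a).filter (· < b) = (S.filter (· < b)).erase a := by
    ext c; simp only [Finset.mem_filter, Finset.mem_erase]; tauto
  have h3 : ((S.filter (· < b)).erase a).card + 1 = (S.filter (· < b)).card :=
    Finset.card_erase_add_one (by simp [ha, hab])
  rw [h1, h2, ← h3, pow_succ]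
  ring

lemma cechD_comp_cechD {i j k : ℤ} (h : i + 1 = j) (h' : j + 1 = k) :
    (cechD x M h').comp (cechD x M h) = 0 := by
  refine LinearMap.ext fun f => funext fun S => ?_
  simp only [LinearMap.comp_apply, LinearMap.zero_apply, Pi.zero_apply]
  -- the value of `f` at `S \ {a, b}`, moved to `M_{x_S}`
  let g : (U : {U : Finset (Fin r) // U ⊆ S.1 ∧ (U.card : ℤ) = i}) → CechLoc x M S.1 :=
    fun U => cechRes x M U.2.1 (f ⟨U.1, U.2.2⟩)
  let F : (Σ a : {a // a ∈ S.1}, {b // b ∈ S.1.erase a.1}) → CechLoc x M S.1 := fun p =>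
    ((-1 : T) ^ (S.1.filter (· < p.1.1)).card *
      (-1) ^ ((S.1.erase p.1.1).filter (· < p.2.1)).card) •
      g ⟨(S.1.erase p.1.1).erase p.2.1,
        (Finset.erase_subset _ _).trans (Finset.erase_subset _ _),
        card_erase_eq h (card_erase_eq h' S.2 p.1.2) p.2.2⟩
  have key : cechD x M h' (cechD x M h f) S = ∑ p, F p := by
    rw [cechD_apply, Fintype.sum_sigma]
    refine Finset.sum_congr rfl fun a _ => ?_
    rw [cechD_apply, map_sum, Finset.smul_sum]
    refine Finset.sum_congr rfl fun b _ => ?_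
    rw [map_smul, smul_smul, ← LinearMap.comp_apply, cechRes_comp]
  rw [key]
  refine Finset.sum_involution
    (fun p _ => ⟨⟨p.2.1, Finset.mem_of_mem_erase p.2.2⟩,
      ⟨p.1.1, Finset.mem_erase.2 ⟨(Finset.ne_of_mem_erase p.2.2).symm, p.1.2⟩⟩⟩) ?_ ?_ ?_ ?_
  · rintro ⟨⟨a, ha⟩, ⟨b, hb⟩⟩ -
    have hbS := Finset.mem_of_mem_erase hb
    have e : (S.1.erase b).erase a = (S.1.erase a).erase b := Finset.erase_right_comm
    simp only [F, e]
    rw [← add_smul]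
    rcases lt_or_gt_of_ne (Finset.ne_of_mem_erase hb) with hlt | hlt
    · rw [add_comm, cech_sign T S.1 hbS hlt, zero_smul]
    · rw [cech_sign T S.1 ha hlt, zero_smul]
  · rintro ⟨⟨a, ha⟩, ⟨b, hb⟩⟩ - - heq
    have := congrArg (fun p : (Σ a : {a // a ∈ S.1}, {b // b ∈ S.1.erase a.1}) => p.1.1) heq
    exact Finset.ne_of_mem_erase hb this
  · intro _ _; exact Finset.mem_univ _
  · intro _ _; rfl

end Cech

open CategoryTheory in
/-- The Čech complex `0 → M → ⨁_j M_{x_j} → ⨁_{j<k} M_{x_j x_k} → ⋯ → M_{x_1 ⋯ x_r} → 0` of the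
`T`-module `M` with respect to `x_1, …, x_r`, with `M` in degree `0`. -/
noncomputable def cechComplex {T : Type u} [CommRing T] {r : ℕ} (x : Fin r → T)
    (M : Type u) [AddCommGroup M] [Module T M] : CochainComplex (ModuleCat.{u} T) ℤ where
  X i := ModuleCat.of T (CechTerm x M i)
  d i j := if h : i + 1 = j then ModuleCat.ofHom (cechD x M h) else 0
  shape i j h := dif_neg h
  d_comp_d' i j k hij hjk := by
    have hij' : i + 1 = j := hij
    have hjk' : j + 1 = k := hjk
    rw [dif_pos hij', dif_pos hjk', ← ModuleCat.ofHom_comp, cechD_comp_cechD]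
    rfl

/-- The local cohomology `H^i(M)`, as a `T`-module, of a `T`-module `M` with support in the ideal
generated by a finite sequence `x` in `R`, where `T` is an `R`-algebra: the `i`-th cohomology of the
Čech complex of `M` with respect to (the image in `T` of) `x`.  It is zero for `i < 0`. -/
noncomputable def cechLocalCohomology {R : Type*} [CommRing R] (T : Type u) [CommRing T]
    [Algebra R T] {r : ℕ} (x : Fin r → R) (M : Type u) [AddCommGroup M] [Module T M] (i : ℤ) :
    ModuleCat.{u} T :=
  (cechComplex (fun j => algebraMap R T (x j)) M).homology i

/-- A `T`-module `M` is almost Cohen–Macaulay over the local ring `(R, 𝔪)`: the local cohomology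
modules `H^i_𝔪(M)` are almost zero for all `i ≠ dim R`, and `M / 𝔪 M` is not almost zero.
Here `H^i_𝔪` is computed by the sequence `x`, which is meant to generate `𝔪` up to radical. -/
def IsAlmostCohenMacaulay {R : Type*} [CommRing R] [IsLocalRing R] {T : Type u} [CommRing T]
    [Algebra R T] (v : ValueMap T) {r : ℕ} (x : Fin r → R)
    (M : Type u) [AddCommGroup M] [Module T M] : Prop :=
  (∀ i : ℕ, (i : WithBot ℕ∞) ≠ ringKrullDim R → IsAlmostZero v (cechLocalCohomology T x M i)) ∧
    ¬ IsAlmostZero v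
      (M ⧸ ((IsLocalRing.maximalIdeal R).map (algebraMap R T) • (⊤ : Submodule T M)))

/-! The Čech complex of `M` is that of `T` tensored with `M`, and its terms are flat. If `T` had
cohomology only in degree `d`, its Čech complex would become, after exactness is extended above `d`,
a flat resolution of `H^d(T)` placed in degrees at most `d`, and tensoring with `M` would compute
Tor. The almost version replaces this by dimension shifting.

Almost zero modules are closed under submodules, quotients and extensions, and localization makes
Čech cohomology a long exact functor of `M`. For `P` projective, a dual basis shows that `H^i(T) ⊗ P
→ H^i(P)` is bijective, so `H^i(P)` is almost zero for `i ≠ d`. Descending induction kills `H^i(M)`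
for `i > d`; hence `H^d` is almost right exact and `H^d(T) ⊗ M → H^d(M)` is an almost isomorphism
(`isAlmostIso_cechTensor`). For `0 → K → P → M → 0` the connecting maps give `H^i(M) ≈ H^{i+1}(K)`
below degree `d - 1`, while `H^{d-1}(M) ≈ ker(H^d(T) ⊗ K → H^d(T) ⊗ P)`
(`sameAlmostIsoClass_cechH_ker_lTensor`). Along a projective resolution with syzygies `K_n` this
matches `Tor_{n+1}(A, M) = ker(A ⊗ K_{n+1} → A ⊗ P_n)`.

If `H^d(T)` were almost zero, so would be `Tor_d(H^d(T), T/𝔪T) ≈ H^0(T/𝔪T)`, which contains `T/𝔪T`.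
-/

section AlmostZero

variable {T : Type*} [CommRing T] {v : ValueMap T}

/-! ### Almost zero modules and almost isomorphisms -/

namespace IsAlmostZero

variable {M N P : Type*} [AddCommGroup M] [Module T M] [AddCommGroup N] [Module T N]
  [AddCommGroup P] [Module T P]

lemma of_injective (h : IsAlmostZero v N) (f : M →ₗ[T] N) (hf : Function.Injective f) :
    IsAlmostZero v M := fun m ε hε => by
  obtain ⟨b, hb, hv⟩ := h (f m) ε hε
  exact ⟨b, hf (by rw [map_smul, hb, map_zero]), hv⟩

lemma of_surjective (h : IsAlmostZero v M) (f : M →ₗ[T] N) (hf : Function.Surjective f) :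
    IsAlmostZero v N := fun n ε hε => by
  obtain ⟨m, rfl⟩ := hf n
  obtain ⟨b, hb, hv⟩ := h m ε hε
  exact ⟨b, by rw [← map_smul, hb, map_zero], hv⟩

/-- If `v` is constantly `∞`, not even the zero module is almost zero; some almost zero module has
to witness that small values occur. -/
lemma of_subsingleton (h : IsAlmostZero v M) [Subsingleton N] : IsAlmostZero v N :=
  h.of_injective 0 (Function.injective_of_subsingleton _)

end IsAlmostZero

lemma ValueMap.mul_lt (v : ValueMap T) {a b : T} {ε : ℝ} (ha : v a < ((ε / 2 : ℝ) : WithTop ℝ))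
    (hb : v b < ((ε / 2 : ℝ) : WithTop ℝ)) : v (a * b) < (ε : WithTop ℝ) := by
  have h : v (a * b) = v a + v b := v.map_mul' a b
  rw [h]
  generalize v a = p at *
  generalize v b = q at *
  lift p to ℝ using ha.ne_top
  lift q to ℝ using hb.ne_top
  norm_cast at *
  linarith

namespace IsAlmostZero

variable {M N P : Type*} [AddCommGroup M] [Module T M] [AddCommGroup N] [Module T N]
  [AddCommGroup P] [Module T P]

/-- Spend `ε / 2` on killing the image in `P`, then `ε / 2` on the element of `M` that the result
comes from. -/
lemma of_exact (hM : IsAlmostZero v M) (hP : IsAlmostZero v P) {f : M →ₗ[T] N} {g : N →ₗ[T] P}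
    (h : Function.Exact f g) : IsAlmostZero v N := fun n ε hε => by
  obtain ⟨b, hb, hvb⟩ := hP (g n) (ε / 2) (by positivity)
  obtain ⟨m, hm⟩ := (h (b • n)).1 (by rw [map_smul, hb])
  obtain ⟨c, hc, hvc⟩ := hM m (ε / 2) (by positivity)
  exact ⟨c * b, by rw [mul_smul, ← hm, ← map_smul, hc, map_zero], v.mul_lt hvc hvb⟩

open scoped TensorProduct in
lemma tensor (hM : IsAlmostZero v M) : IsAlmostZero v (M ⊗[T] N) := fun t => by
  induction t using TensorProduct.induction_on with
  | zero =>
    intro ε hε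
    obtain ⟨b, -, hb⟩ := hM 0 ε hε
    exact ⟨b, smul_zero _, hb⟩
  | tmul m n =>
    intro ε hε
    obtain ⟨b, hb, hvb⟩ := hM m ε hε
    exact ⟨b, by rw [TensorProduct.smul_tmul', hb, TensorProduct.zero_tmul], hvb⟩
  | add s t hs ht =>
    intro ε hε
    obtain ⟨b, hb, hvb⟩ := hs (ε / 2) (by positivity)
    obtain ⟨c, hc, hvc⟩ := ht (ε / 2) (by positivity)
    exact ⟨b * c, by rw [smul_add, mul_smul b c t, hc, mul_comm, mul_smul, hb]; simp,
      v.mul_lt hvb hvc⟩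

end IsAlmostZero

section

variable {M N P : Type*} [AddCommGroup M] [Module T M] [AddCommGroup N] [Module T N]
  [AddCommGroup P] [Module T P]

lemma isAlmostZero_ker_iff (f : M →ₗ[T] N) : IsAlmostZero v (LinearMap.ker f) ↔
    ∀ m, f m = 0 → ∀ ε : ℝ, 0 < ε → ∃ b : T, b • m = 0 ∧ v b < (ε : WithTop ℝ) := by
  constructor
  · intro h m hm ε hε
    obtain ⟨b, hb, hv⟩ := h ⟨m, hm⟩ ε hε
    exact ⟨b, congrArg Subtype.val hb, hv⟩
  · rintro h ⟨m, hm⟩ ε hε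
    obtain ⟨b, hb, hv⟩ := h m hm ε hε
    exact ⟨b, Subtype.ext hb, hv⟩

lemma isAlmostZero_coker_iff (f : M →ₗ[T] N) : IsAlmostZero v (N ⧸ LinearMap.range f) ↔
    ∀ (n : N) (ε : ℝ), 0 < ε → ∃ (b : T) (m : M), f m = b • n ∧ v b < (ε : WithTop ℝ) := by
  constructor
  · intro h n ε hε
    obtain ⟨b, hb, hv⟩ := h (Submodule.Quotient.mk n) ε hε
    rw [← Submodule.Quotient.mk_smul, Submodule.Quotient.mk_eq_zero] at hb
    obtain ⟨m, hm⟩ := hb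
    exact ⟨b, m, hm, hv⟩
  · intro h n ε hε
    obtain ⟨n, rfl⟩ := Submodule.Quotient.mk_surjective _ n
    obtain ⟨b, m, hm, hv⟩ := h n ε hε
    refine ⟨b, ?_, hv⟩
    rw [← Submodule.Quotient.mk_smul, Submodule.Quotient.mk_eq_zero]
    exact ⟨m, hm⟩

lemma isAlmostZero_ker_of_exact {f : M →ₗ[T] N} {g : N →ₗ[T] P} (h : Function.Exact f g)
    (hM : IsAlmostZero v M) : IsAlmostZero v (LinearMap.ker g) := by
  rw [h.linearMap_ker_eq]
  exact hM.of_surjective f.rangeRestrict f.surjective_rangeRestrict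

lemma isAlmostZero_coker_of_exact {f : M →ₗ[T] N} {g : N →ₗ[T] P} (h : Function.Exact f g)
    (hP : IsAlmostZero v P) : IsAlmostZero v (N ⧸ LinearMap.range f) := by
  rw [← h.linearMap_ker_eq]
  exact hP.of_injective ((LinearMap.ker g).liftQ g le_rfl)
    (LinearMap.ker_eq_bot.1 (Submodule.ker_liftQ_eq_bot _ _ _ le_rfl))

/-- A linear map which is bijective is an almost isomorphism, as soon as the zero module is almost
zero. -/
lemma IsAlmostIso.of_bijective {Q : Type*} [AddCommGroup Q] [Module T Q] (hQ : IsAlmostZero v Q)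
    {f : M →ₗ[T] N} (hf : Function.Bijective f) : IsAlmostIso v f := by
  constructor
  · rw [LinearMap.ker_eq_bot.2 hf.1]
    exact hQ.of_subsingleton
  · rw [LinearMap.range_eq_top.2 hf.2]
    exact hQ.of_subsingleton

lemma IsAlmostIso.comp {f : M →ₗ[T] N} {g : N →ₗ[T] P} (hg : IsAlmostIso v g)
    (hf : IsAlmostIso v f) : IsAlmostIso v (g ∘ₗ f) := by
  obtain ⟨hf1, hf2⟩ := hf
  obtain ⟨hg1, hg2⟩ := hg
  rw [isAlmostZero_ker_iff] at hf1 hg1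
  rw [isAlmostZero_coker_iff] at hf2 hg2
  refine ⟨(isAlmostZero_ker_iff _).2 fun m hm ε hε => ?_,
    (isAlmostZero_coker_iff _).2 fun p ε hε => ?_⟩
  · obtain ⟨b, hb, hvb⟩ := hg1 (f m) hm (ε / 2) (by positivity)
    obtain ⟨c, hc, hvc⟩ := hf1 (b • m) (by rw [map_smul, hb]) (ε / 2) (by positivity)
    exact ⟨c * b, by rw [mul_smul, hc], v.mul_lt hvc hvb⟩
  · obtain ⟨b, n, hn, hvb⟩ := hg2 p (ε / 2) (by positivity)
    obtain ⟨c, m, hm, hvc⟩ := hf2 n (ε / 2) (by positivity)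
    exact ⟨c * b, m, by rw [LinearMap.comp_apply, hm, map_smul, hn, mul_smul], v.mul_lt hvc hvb⟩

lemma IsAlmostIso.isAlmostZero_left {f : M →ₗ[T] N} (hf : IsAlmostIso v f)
    (hN : IsAlmostZero v N) : IsAlmostZero v M :=
  hf.1.of_exact hN (f := (LinearMap.ker f).subtype) (g := f) (LinearMap.exact_subtype_ker_map f)

lemma IsAlmostIso.isAlmostZero_right {f : M →ₗ[T] N} (hf : IsAlmostIso v f)
    (hM : IsAlmostZero v M) : IsAlmostZero v N :=
  hM.of_exact hf.2 (f := f) (g := (LinearMap.range f).mkQ) (LinearMap.exact_map_mkQ_range f)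

/-- The base change of an almost isomorphism `f` along `g` is an almost isomorphism. -/
lemma IsAlmostIso.pullback_snd {f : M →ₗ[T] P} (hf : IsAlmostIso v f) (g : N →ₗ[T] P) :
    IsAlmostIso v (LinearMap.snd T M N ∘ₗ
      (LinearMap.eqLocus (f ∘ₗ LinearMap.fst T M N) (g ∘ₗ LinearMap.snd T M N)).subtype) := by
  obtain ⟨hf1, hf2⟩ := hf
  rw [isAlmostZero_ker_iff] at hf1
  rw [isAlmostZero_coker_iff] at hf2
  refine ⟨(isAlmostZero_ker_iff _).2 ?_, (isAlmostZero_coker_iff _).2 fun n ε hε => ?_⟩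
  · rintro ⟨⟨m, n⟩, hmn⟩ h ε hε
    have hn : n = 0 := h
    have hm : f m = g n := hmn
    obtain ⟨b, hb, hv⟩ := hf1 m (by rw [hm, hn, map_zero]) ε hε
    exact ⟨b, Subtype.ext (Prod.ext hb (by simp [hn])), hv⟩
  · obtain ⟨b, m, hm, hv⟩ := hf2 (g n) ε hε
    exact ⟨b, ⟨⟨m, b • n⟩, by simp [LinearMap.mem_eqLocus, hm]⟩, rfl, hv⟩

lemma IsAlmostIso.pullback_fst {g : N →ₗ[T] P} (hg : IsAlmostIso v g) (f : M →ₗ[T] P) :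
    IsAlmostIso v (LinearMap.fst T M N ∘ₗ
      (LinearMap.eqLocus (f ∘ₗ LinearMap.fst T M N) (g ∘ₗ LinearMap.snd T M N)).subtype) := by
  obtain ⟨hg1, hg2⟩ := hg
  rw [isAlmostZero_ker_iff] at hg1
  rw [isAlmostZero_coker_iff] at hg2
  refine ⟨(isAlmostZero_ker_iff _).2 ?_, (isAlmostZero_coker_iff _).2 fun m ε hε => ?_⟩
  · rintro ⟨⟨m, n⟩, hmn⟩ h ε hε
    have hm : m = 0 := h
    have hn : f m = g n := hmn
    obtain ⟨b, hb, hv⟩ := hg1 n (by rw [← hn, hm, map_zero]) ε hε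
    exact ⟨b, Subtype.ext (Prod.ext (by simp [hm]) hb), hv⟩
  · obtain ⟨b, n, hn, hv⟩ := hg2 (f m) ε hε
    exact ⟨b, ⟨⟨b • m, n⟩, by simp [LinearMap.mem_eqLocus, hn]⟩, rfl, hv⟩

end

end AlmostZero

/-! ### The relation `≈` -/

namespace SameAlmostIsoClass

variable {T : Type u} [CommRing T] {v : ValueMap T} {M N P : ModuleCat.{u} T}

lemma symm (h : SameAlmostIsoClass v M N) : SameAlmostIsoClass v N M := by
  obtain ⟨L, f, g, hf, hg⟩ := h
  exact ⟨L, g, f, hg, hf⟩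

/-- The two roofs are joined by the fibre product of `L` and `L'` over `N`, whose projections are
base changes of almost isomorphisms. -/
lemma trans (h : SameAlmostIsoClass v M N) (h' : SameAlmostIsoClass v N P) :
    SameAlmostIsoClass v M P := by
  obtain ⟨L, f, g, hf, hg⟩ := h
  obtain ⟨L', f', g', hf', hg'⟩ := h'
  exact ⟨ModuleCat.of T
    (LinearMap.eqLocus (g ∘ₗ LinearMap.fst T L L') (f' ∘ₗ LinearMap.snd T L L')), _, _,
    hf.comp (hf'.pullback_fst g), hg'.comp (hg.pullback_snd f')⟩

lemma of_isAlmostIso {Q : Type*} [AddCommGroup Q] [Module T Q] (hQ : IsAlmostZero v Q)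
    (f : M →ₗ[T] N) (hf : IsAlmostIso v f) : SameAlmostIsoClass v M N :=
  ⟨M, LinearMap.id, f, .of_bijective hQ Function.bijective_id, hf⟩

lemma of_iso {Q : Type*} [AddCommGroup Q] [Module T Q] (hQ : IsAlmostZero v Q)
    (e : M ≅ N) : SameAlmostIsoClass v M N :=
  of_isAlmostIso hQ e.toLinearEquiv.toLinearMap (.of_bijective hQ e.toLinearEquiv.bijective)

lemma isAlmostZero_right (h : SameAlmostIsoClass v M N) (hM : IsAlmostZero v M) :
    IsAlmostZero v N := by
  obtain ⟨L, f, g, hf, hg⟩ := h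
  exact hg.isAlmostZero_right (hf.isAlmostZero_left hM)

end SameAlmostIsoClass

/-! ### Functoriality and exactness of the Čech terms -/

section CechMap

variable {T : Type*} [CommRing T] {r : ℕ} (x : Fin r → T)
  {M N P : Type*} [AddCommGroup M] [Module T M] [AddCommGroup N] [Module T N]
  [AddCommGroup P] [Module T P]

/-- The map `M_{x_S} → N_{x_S}` induced by a linear map `M → N`. -/
noncomputable def cechLocMap (S : Finset (Fin r)) :
    (M →ₗ[T] N) →ₗ[T] (CechLoc x M S →ₗ[T] CechLoc x N S) :=
  IsLocalizedModule.map (Submonoid.powers (∏ j ∈ S, x j))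
    (LocalizedModule.mkLinearMap _ M) (LocalizedModule.mkLinearMap _ N)

lemma cechLocMap_mk (S : Finset (Fin r)) (f : M →ₗ[T] N) (m : M)
    (s : Submonoid.powers (∏ j ∈ S, x j)) :
    cechLocMap x S f (LocalizedModule.mk m s) = LocalizedModule.mk (f m) s :=
  IsLocalizedModule.map_LocalizedModules ..

lemma cechLocMap_cechRes {U S : Finset (Fin r)} (h : U ⊆ S) (f : M →ₗ[T] N)
    (z : CechLoc x M U) :
    cechLocMap x S f (cechRes x M h z) = cechRes x N h (cechLocMap x U f z) := by
  suffices h' : cechLocMap x S f ∘ₗ cechRes x M h = cechRes x N h ∘ₗ cechLocMap x U f from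
    LinearMap.congr_fun h' z
  refine IsLocalizedModule.ext (Submonoid.powers (∏ j ∈ U, x j)) (LocalizedModule.mkLinearMap _ M)
    (cechLoc_isUnit x N h) (LinearMap.ext fun m => ?_)
  simp only [LinearMap.comp_apply]
  have h2 : ∀ (V : Finset (Fin r)) (m : M), cechLocMap x V f (LocalizedModule.mkLinearMap _ M m) =
      LocalizedModule.mkLinearMap _ N (f m) := fun V m => cechLocMap_mk x V f m 1
  have h3 : cechRes x N h (LocalizedModule.mkLinearMap _ N (f m)) =
      LocalizedModule.mkLinearMap _ N (f m) :=
    LinearMap.congr_fun (LocalizedModule.lift_comp _ _ (cechLoc_isUnit x N h)) (f m)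
  have h4 : cechRes x M h (LocalizedModule.mkLinearMap _ M m) =
      LocalizedModule.mkLinearMap _ M m :=
    LinearMap.congr_fun (LocalizedModule.lift_comp _ _ (cechLoc_isUnit x M h)) m
  rw [h4, h2, h2, h3]

/-- The map between the terms of the Čech complexes induced by a linear map. -/
noncomputable def cechTermMap (i : ℤ) :
    (M →ₗ[T] N) →ₗ[T] (CechTerm x M i →ₗ[T] CechTerm x N i) where
  toFun f := LinearMap.pi fun S => cechLocMap x S.1 f ∘ₗ LinearMap.proj S
  map_add' f g := by ext z S; simp
  map_smul' a f := by ext z S; simp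

@[simp]
lemma cechTermMap_apply (i : ℤ) (f : M →ₗ[T] N) (z : CechTerm x M i)
    (S : {S : Finset (Fin r) // (S.card : ℤ) = i}) :
    cechTermMap x i f z S = cechLocMap x S.1 f (z S) := rfl

lemma cechTermMap_cechD {i j : ℤ} (h : i + 1 = j) (f : M →ₗ[T] N) (z : CechTerm x M i) :
    cechTermMap x j f (cechD x M h z) = cechD x N h (cechTermMap x i f z) := by
  funext S
  simp only [cechTermMap_apply, cechD_apply, map_sum, map_smul, cechLocMap_cechRes]

lemma cechTermMap_id (i : ℤ) : cechTermMap x i (LinearMap.id : M →ₗ[T] M) = LinearMap.id := by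
  refine LinearMap.ext fun z => funext fun S => ?_
  rw [cechTermMap_apply, cechLocMap, IsLocalizedModule.map_id]
  rfl

lemma cechTermMap_comp (i : ℤ) (g : N →ₗ[T] P) (f : M →ₗ[T] N) :
    cechTermMap x i (g ∘ₗ f) = cechTermMap x i g ∘ₗ cechTermMap x i f := by
  refine LinearMap.ext fun z => funext fun S => ?_
  simp only [cechTermMap_apply, LinearMap.comp_apply]
  rw [cechLocMap, IsLocalizedModule.map_comp' (Submonoid.powers (∏ j ∈ S.1, x j))
    (LocalizedModule.mkLinearMap (Submonoid.powers (∏ j ∈ S.1, x j)) M)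
    (LocalizedModule.mkLinearMap (Submonoid.powers (∏ j ∈ S.1, x j)) N)
    (LocalizedModule.mkLinearMap (Submonoid.powers (∏ j ∈ S.1, x j)) P)]
  rfl

lemma cechTermMap_injective (i : ℤ) {f : M →ₗ[T] N} (hf : Function.Injective f) :
    Function.Injective (cechTermMap x i f) := fun _ _ h => funext fun S =>
  IsLocalizedModule.map_injective _ _ _ f hf (congrFun h S)

lemma cechTermMap_surjective (i : ℤ) {f : M →ₗ[T] N} (hf : Function.Surjective f) :
    Function.Surjective (cechTermMap x i f) := fun w => by
  choose z hz using fun S : {S : Finset (Fin r) // (S.card : ℤ) = i} =>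
    show ∃ z, cechLocMap x S.1 f z = w S from IsLocalizedModule.map_surjective _ _ _ f hf (w S)
  exact ⟨z, funext hz⟩

lemma cechTermMap_exact (i : ℤ) {f : M →ₗ[T] N} {g : N →ₗ[T] P} (h : Function.Exact f g) :
    Function.Exact (cechTermMap x i f) (cechTermMap x i g) := by
  have hS : ∀ S : {S : Finset (Fin r) // (S.card : ℤ) = i},
      Function.Exact (cechLocMap x S.1 f) (cechLocMap x S.1 g) := fun S =>
    IsLocalizedModule.map_exact _ _ _ _ f g h
  intro w
  constructor
  · intro hw
    choose z hz using fun S => (hS S (w S)).1 (congrFun hw S)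
    exact ⟨z, funext hz⟩
  · rintro ⟨z, rfl⟩
    exact funext fun S => (hS S _).2 ⟨z S, rfl⟩

/-- An element of a term of the Čech complex of `M` involves only finitely many elements of `M`. -/
lemma exists_finset_cechTermMap_eq_self (i : ℤ) (z : CechTerm x M i) :
    ∃ B : Finset M, ∀ g : M →ₗ[T] M, (∀ m ∈ B, g m = m) → cechTermMap x i g z = z := by
  classical
  have hz : ∀ S : {S : Finset (Fin r) // (S.card : ℤ) = i}, ∃ (m : M)
      (s : Submonoid.powers (∏ j ∈ S.1, x j)), z S = LocalizedModule.mk m s := fun S => by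
    generalize z S = w
    induction w using LocalizedModule.induction_on with
    | h m s => exact ⟨m, s, rfl⟩
  -- One numerator for each of the finitely many `S` suffices, since the induced map acts on
  -- numerators only.
  choose m s hms using hz
  refine ⟨Finset.univ.image m, fun g hg => funext fun S => ?_⟩
  rw [cechTermMap_apply, hms, cechLocMap_mk, hg _ (Finset.mem_image_of_mem m (Finset.mem_univ S))]

end CechMap

open CategoryTheory
open scoped TensorProduct

/-! ### Čech cohomology as a functor, and its long exact sequence -/

section CechFunctor

variable {T : Type u} [CommRing T] {r : ℕ} (x : Fin r → T)

lemma cechComplex_d (M : Type u) [AddCommGroup M] [Module T M] {i j : ℤ} (h : i + 1 = j) :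
    (cechComplex x M).d i j = ModuleCat.ofHom (cechD x M h) := dif_pos h

/-- The Čech complex as a functor. -/
noncomputable def cechFunctor : ModuleCat.{u} T ⥤ CochainComplex (ModuleCat.{u} T) ℤ where
  obj M := cechComplex x M
  map f :=
    { f := fun i => ModuleCat.ofHom (cechTermMap x i f.hom)
      comm' := fun i j h => by
        rw [cechComplex_d x _ h, cechComplex_d x _ h]
        exact congrArg ModuleCat.ofHom
          (LinearMap.ext fun z => (cechTermMap_cechD x h f.hom z).symm) }
  map_id M := by
    ext i : 1
    exact congrArg ModuleCat.ofHom (cechTermMap_id x i)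
  map_comp f g := by
    ext i : 1
    exact congrArg ModuleCat.ofHom (cechTermMap_comp x i g.hom f.hom)

instance : (cechFunctor x).Additive where
  map_add {M N f g} := by
    ext i : 1
    exact congrArg ModuleCat.ofHom (map_add (cechTermMap x i) f.hom g.hom)

/-- The `i`-th cohomology of the Čech complex, as a functor. -/
noncomputable abbrev cechH (i : ℤ) : ModuleCat.{u} T ⥤ ModuleCat.{u} T :=
  cechFunctor x ⋙ HomologicalComplex.homologyFunctor _ _ i

instance (i : ℤ) : (HomologicalComplex.homologyFunctor (ModuleCat.{u} T) (ComplexShape.up ℤ) i).Additive where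
  map_add := HomologicalComplex.homologyMap_add ..

/-- Linearity over `T`, beyond additivity, is what makes the pairing `H^i(T) × M → H^i(M)` bilinear
over `T`. -/
lemma cechH_map_smul (i : ℤ) {M N : ModuleCat.{u} T} (a : T) (f : M ⟶ N) :
    (cechH x i).map (a • f) = a • (cechH x i).map f := by
  let φ := (HomologicalComplex.shortComplexFunctor _ _ i).map ((cechFunctor x).map f)
  have h : ((HomologicalComplex.shortComplexFunctor _ _ i).map ((cechFunctor x).map (a • f))) =
      a • φ := by
    ext : 1 <;> exact congrArg ModuleCat.ofHom (map_smul (cechTermMap x _) a f.hom)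
  have h' := ShortComplex.homologyMap_smul (R := T) φ a
  rw [← h] at h'
  exact h'

/-- Starts the descending induction above `d`, and covers the negative degrees, on which the almost
Cohen–Macaulay condition is silent. -/
lemma subsingleton_cechH (i : ℤ) (h : i < 0 ∨ (r : ℤ) < i) (M : ModuleCat.{u} T) :
    Subsingleton ((cechH x i).obj M) := by
  have : IsEmpty {S : Finset (Fin r) // (S.card : ℤ) = i} := ⟨fun S => by
    have h1 := S.2
    have h2 := card_finset_fin_le S.1
    omega⟩
  have : Subsingleton (((cechFunctor x).obj M).X i) :=
    inferInstanceAs (Subsingleton (CechTerm x M i))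
  exact ModuleCat.subsingleton_of_isZero (HomologicalComplex.ExactAt.isZero_homology
    (HomologicalComplex.ExactAt.of_isZero (ModuleCat.isZero_of_subsingleton _)))

section LongExactSequence

variable {S : ShortComplex (ModuleCat.{u} T)} (hS : S.ShortExact)

include hS in
lemma shortExact_map_cechFunctor : (S.map (cechFunctor x)).ShortExact := by
  have h1 := hS.moduleCat_injective_f
  have h2 := hS.moduleCat_surjective_g
  have h3 := (ShortComplex.ShortExact.moduleCat_exact_iff_function_exact S).1 hS.exact
  refine HomologicalComplex.shortExact_of_degreewise_shortExact _ fun i => ?_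
  refine ModuleCat.shortComplex_shortExact _ ?_ ?_ ?_
  · exact cechTermMap_exact x i h3
  · exact cechTermMap_injective x i h1
  · exact cechTermMap_surjective x i h2

/-- The connecting map of the long exact sequence of Čech cohomology. -/
noncomputable def cechδ (i j : ℤ) (h : i + 1 = j) : (cechH x i).obj S.X₃ ⟶ (cechH x j).obj S.X₁ :=
  (shortExact_map_cechFunctor x hS).δ i j h

lemma cechH_exact₁ (i j : ℤ) (h : i + 1 = j) :
    Function.Exact (cechδ x hS i j h) ((cechH x j).map S.f) :=
  (ShortComplex.ShortExact.moduleCat_exact_iff_function_exact _).1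
    ((shortExact_map_cechFunctor x hS).homology_exact₁ i j h)

include hS in
lemma cechH_exact₂ (i : ℤ) :
    Function.Exact ((cechH x i).map S.f) ((cechH x i).map S.g) :=
  (ShortComplex.ShortExact.moduleCat_exact_iff_function_exact _).1
    ((shortExact_map_cechFunctor x hS).homology_exact₂ i)

lemma cechH_exact₃ (i j : ℤ) (h : i + 1 = j) :
    Function.Exact ((cechH x i).map S.g) (cechδ x hS i j h) :=
  (ShortComplex.ShortExact.moduleCat_exact_iff_function_exact _).1
    ((shortExact_map_cechFunctor x hS).homology_exact₃ i j h)

end LongExactSequence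

end CechFunctor

/-! ### The comparison map `H^i(T) ⊗ M → H^i(M)` -/

section CechTensor

variable {T : Type u} [CommRing T] {r : ℕ} (x : Fin r → T) (i : ℤ)

/-- The `T`-linear map on Čech cohomology induced by a linear map. -/
noncomputable def cechHMap (M N : ModuleCat.{u} T) :
    (M →ₗ[T] N) →ₗ[T] ((cechH x i).obj M →ₗ[T] (cechH x i).obj N) where
  toFun f := ((cechH x i).map (ModuleCat.ofHom f)).hom
  map_add' f g := congrArg ModuleCat.Hom.hom
    ((cechH x i).map_add (f := ModuleCat.ofHom f) (g := ModuleCat.ofHom g))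
  map_smul' a f := congrArg ModuleCat.Hom.hom (cechH_map_smul x i a (ModuleCat.ofHom f))

variable {x i}

lemma cechHMap_comp_apply {M N P : ModuleCat.{u} T} (g : N →ₗ[T] P) (f : M →ₗ[T] N)
    (h : (cechH x i).obj M) :
    cechHMap x i M P (g ∘ₗ f) h = cechHMap x i N P g (cechHMap x i M N f h) :=
  congrArg (fun k : (cechH x i).obj M ⟶ (cechH x i).obj P => k.hom h)
    ((cechH x i).map_comp (ModuleCat.ofHom f) (ModuleCat.ofHom g))

lemma cechHMap_id_apply {M : ModuleCat.{u} T} (h : (cechH x i).obj M) :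
    cechHMap x i M M LinearMap.id h = h :=
  congrArg (fun k : (cechH x i).obj M ⟶ (cechH x i).obj M => k.hom h) ((cechH x i).map_id M)

/-- A class in the Čech cohomology of `M` involves only finitely many elements of `M`. -/
lemma exists_finset_cechHMap_eq_self {M : ModuleCat.{u} T} (h : (cechH x i).obj M) :
    ∃ B : Finset M, ∀ g : M →ₗ[T] M, (∀ m ∈ B, g m = m) → cechHMap x i M M g h = h := by
  let K := (cechFunctor x).obj M
  obtain ⟨c, rfl⟩ := (ModuleCat.epi_iff_surjective (K.homologyπ i)).1 inferInstance h
  obtain ⟨B, hB⟩ := exists_finset_cechTermMap_eq_self x i (K.iCycles i c)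
  refine ⟨B, fun g hg => ?_⟩
  let φ : K ⟶ K := (cechFunctor x).map (ModuleCat.ofHom g)
  -- The map fixes the cochain underlying `c`, and cocycles embed in cochains, so it fixes `c`
  -- itself.
  have h1 : HomologicalComplex.cyclesMap φ i c = c := by
    refine (ModuleCat.mono_iff_injective (K.iCycles i)).1 inferInstance ?_
    refine Eq.trans ?_ (hB g hg)
    exact congrArg (fun k : K.cycles i ⟶ K.X i => k.hom c) (HomologicalComplex.cyclesMap_i φ i)
  have h2 : HomologicalComplex.homologyMap φ i (K.homologyπ i c) =
      K.homologyπ i (HomologicalComplex.cyclesMap φ i c) :=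
    congrArg (fun k : K.cycles i ⟶ K.homology i => k.hom c)
      (HomologicalComplex.homologyπ_naturality φ i)
  rw [h1] at h2
  exact h2

variable (x i)

/-- The natural map `H^i(T) ⊗ M → H^i(M)`. -/
noncomputable def cechTensor (M : ModuleCat.{u} T) :
    (cechH x i).obj (ModuleCat.of T T) ⊗[T] M →ₗ[T] (cechH x i).obj M :=
  -- An element `m` is read as the map `T → M`, `1 ↦ m`, to which `H^i` is applied.
  TensorProduct.lift (cechHMap x i (ModuleCat.of T T) M ∘ₗ
    (LinearMap.ringLmapEquivSelf T T M).symm.toLinearMap).flip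

variable {x i}

lemma cechTensor_tmul {M : ModuleCat.{u} T} (h : (cechH x i).obj (ModuleCat.of T T)) (m : M) :
    cechTensor x i M (h ⊗ₜ m) =
      cechHMap x i (ModuleCat.of T T) M (LinearMap.toSpanSingleton T M m) h := by
  simp [cechTensor]
  rfl

lemma cechTensor_naturality {M N : ModuleCat.{u} T} (f : M →ₗ[T] N)
    (t : (cechH x i).obj (ModuleCat.of T T) ⊗[T] M) :
    cechTensor x i N (f.lTensor _ t) = cechHMap x i M N f (cechTensor x i M t) := by
  induction t using TensorProduct.induction_on with
  | zero => simp
  | add s t hs ht => simp only [map_add, hs, ht]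
  | tmul h m =>
    rw [LinearMap.lTensor_tmul, cechTensor_tmul, cechTensor_tmul, ← cechHMap_comp_apply]
    congr 2
    ext
    simp

/-- Dual basis: the identity of `P` is `∑ c_p(-) p`, possibly an infinite sum, but a class `h` sees
only finitely many elements of `P`. A finite partial sum therefore fixes `h`, and `h` is the image
of `∑ H^i(c_p)(h) ⊗ p`. -/
lemma cechTensor_surjective_of_projective {P : ModuleCat.{u} T} (hP : Module.Projective T P) :
    Function.Surjective (cechTensor x i P) := fun h => by
  classical
  obtain ⟨s, hs⟩ := hP.out
  obtain ⟨B, hB⟩ := exists_finset_cechHMap_eq_self h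
  let A : Finset P := B.biUnion fun m => (s m).support
  let c (p : P) : P →ₗ[T] ModuleCat.of T T := Finsupp.lapply p ∘ₗ s
  have hg := hB (∑ p ∈ A, LinearMap.toSpanSingleton T P p ∘ₗ c p) fun m hm => by
    have h1 : (s m).sum (fun p a => a • p) = m := by
      simpa [Finsupp.linearCombination_apply] using hs m
    rw [Finsupp.sum_of_support_subset (s m) (Finset.subset_biUnion_of_mem (fun m => (s m).support) hm)
      _ (by simp)] at h1
    simpa [LinearMap.sum_apply, c] using h1
  refine ⟨∑ p ∈ A, cechHMap x i P (ModuleCat.of T T) (c p) h ⊗ₜ p, ?_⟩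
  rw [map_sum, LinearMap.sum_apply] at hg
  rw [map_sum, ← hg]
  refine Finset.sum_congr rfl fun p _ => ?_
  rw [cechTensor_tmul, ← cechHMap_comp_apply, hg]

/-- If `∑ h_k ⊗ m_k` maps to zero, applying `H^i(c_p)` gives `∑ c_p(m_k) h_k = 0` for each
coordinate `c_p`. Expanding the `m_k` in the dual basis makes these sums the coefficients of the
tensor. -/
lemma cechTensor_injective_of_projective {P : ModuleCat.{u} T} (hP : Module.Projective T P) :
    Function.Injective (cechTensor x i P) := by
  classical
  obtain ⟨s, hs⟩ := hP.out
  let c (p : P) : P →ₗ[T] ModuleCat.of T T := Finsupp.lapply p ∘ₗ s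
  rw [injective_iff_map_eq_zero]
  intro t ht
  obtain ⟨n, h, m, rfl⟩ := TensorProduct.exists_sum_tmul_eq t
  have key (p : P) : ∑ k, (s (m k) p) • h k = 0 := by
    have h1 := congrArg (cechHMap x i P (ModuleCat.of T T) (c p)) ht
    rw [map_zero, ← cechTensor_naturality, map_sum, map_sum] at h1
    rw [← h1]
    refine Finset.sum_congr rfl fun k _ => ?_
    rw [LinearMap.lTensor_tmul, cechTensor_tmul]
    have h2 : LinearMap.toSpanSingleton T (ModuleCat.of T T) (c p (m k)) =
        (s (m k) p) • LinearMap.id := by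
      ext
      simp [c]
    rw [h2, map_smul, LinearMap.smul_apply, cechHMap_id_apply]
  let A : Finset P := Finset.univ.biUnion fun k => (s (m k)).support
  have hm (k : Fin n) : m k = ∑ p ∈ A, s (m k) p • p := by
    have h1 : (s (m k)).sum (fun p a => a • p) = m k := by
      simpa [Finsupp.linearCombination_apply] using hs (m k)
    rw [Finsupp.sum_of_support_subset (s (m k))
      (Finset.subset_biUnion_of_mem (fun k => (s (m k)).support) (Finset.mem_univ k)) _
      (by simp)] at h1
    exact h1.symm
  calc ∑ k, h k ⊗ₜ[T] m k = ∑ k, ∑ p ∈ A, (s (m k) p • h k) ⊗ₜ[T] p := by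
        refine Finset.sum_congr rfl fun k _ => ?_
        conv_lhs => rw [hm k]
        simp only [TensorProduct.tmul_sum, TensorProduct.tmul_smul, TensorProduct.smul_tmul']
    _ = ∑ p ∈ A, (∑ k, s (m k) p • h k) ⊗ₜ[T] p := by
        rw [Finset.sum_comm]
        simp only [TensorProduct.sum_tmul]
    _ = 0 := by simp [key]

end CechTensor

/-! ### Dimension shifting when `H^i(T)` is almost zero for `i ≠ d` -/

section AlmostCech

variable {T : Type u} [CommRing T] {v : ValueMap T} {r : ℕ} {x : Fin r → T} {d : ℤ}

lemma exists_shortExact_projective (M : ModuleCat.{u} T) :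
    ∃ S : ShortComplex (ModuleCat.{u} T), S.ShortExact ∧ Module.Projective T S.X₂ ∧ S.X₃ = M :=
  ⟨_, LinearMap.shortExact_shortComplexKer (Finsupp.linearCombination_id_surjective T M),
    inferInstanceAs (Module.Projective T (M →₀ T)), rfl⟩

variable (hT : ∀ i, i ≠ d → IsAlmostZero v ((cechH x i).obj (ModuleCat.of T T)))

include hT

lemma isAlmostZero_cechH_of_projective {P : ModuleCat.{u} T} (hP : Module.Projective T P) {i : ℤ}
    (hi : i ≠ d) : IsAlmostZero v ((cechH x i).obj P) :=
  (hT i hi).tensor.of_surjective _ (cechTensor_surjective_of_projective hP)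

/-- Descending induction on `i` from beyond `r`, through `H^i(P) → H^i(M) → H^{i+1}(K)`. -/
lemma isAlmostZero_cechH_of_lt (M : ModuleCat.{u} T) {i : ℤ} (hi : d < i) :
    IsAlmostZero v ((cechH x i).obj M) := by
  obtain ⟨n, hn⟩ : ∃ n : ℕ, (r : ℤ) < i + n := ⟨(r + 1 - i).toNat, by omega⟩
  induction n generalizing i M with
  | zero =>
    have := subsingleton_cechH x i (.inr (by simpa using hn)) M
    exact (hT i hi.ne').of_subsingleton
  | succ n ih =>
    obtain ⟨S, hS, hP, rfl⟩ := exists_shortExact_projective M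
    exact (isAlmostZero_cechH_of_projective hT hP hi.ne').of_exact
      (ih S.X₁ (i := i + 1) (by omega) (by push_cast at hn; omega))
      (f := ((cechH x i).map S.g).hom) (g := (cechδ x hS i _ rfl).hom)
      (cechH_exact₃ x hS i _ rfl)

/-- The map `H^d(P) → H^d(M)` induced by a surjection from a projective module is almost
surjective. -/
lemma isAlmostZero_coker_cechH_map {S : ShortComplex (ModuleCat.{u} T)} (hS : S.ShortExact) :
    IsAlmostZero v ((cechH x d).obj S.X₃ ⧸ LinearMap.range ((cechH x d).map S.g).hom) :=
  isAlmostZero_coker_of_exact (g := (cechδ x hS d _ rfl).hom) (cechH_exact₃ x hS d _ rfl)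
    (isAlmostZero_cechH_of_lt hT S.X₁ (by omega))

lemma isAlmostZero_coker_cechTensor (M : ModuleCat.{u} T) :
    IsAlmostZero v ((cechH x d).obj M ⧸ LinearMap.range (cechTensor x d M)) := by
  obtain ⟨S, hS, hP, rfl⟩ := exists_shortExact_projective M
  have h := isAlmostZero_coker_cechH_map hT hS
  rw [isAlmostZero_coker_iff] at h ⊢
  intro y ε hε
  obtain ⟨b, z, hz, hv⟩ := h y ε hε
  obtain ⟨t, rfl⟩ := cechTensor_surjective_of_projective hP z
  exact ⟨b, S.g.hom.lTensor _ t, (cechTensor_naturality S.g.hom t).trans hz, hv⟩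

/-- A four lemma for the kernel: lift `t` to `H^d(T) ⊗ P`. Its image in `H^d(P)` comes from
`H^d(K)`, hence, up to a multiple `b`, from `H^d(T) ⊗ K`. Injectivity for `P` shows that `b` times
the lift comes from `H^d(T) ⊗ K`, so `b • t = 0`. -/
lemma isAlmostIso_cechTensor (M : ModuleCat.{u} T) : IsAlmostIso v (cechTensor x d M) := by
  refine ⟨?_, isAlmostZero_coker_cechTensor hT M⟩
  obtain ⟨S, hS, hP, rfl⟩ := exists_shortExact_projective M
  have h := isAlmostZero_coker_cechTensor hT S.X₁
  rw [isAlmostZero_coker_iff] at h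
  rw [isAlmostZero_ker_iff]
  intro t ht ε hε
  have hex : Function.Exact S.f.hom S.g.hom :=
    (ShortComplex.ShortExact.moduleCat_exact_iff_function_exact S).1 hS.exact
  obtain ⟨t, rfl⟩ := LinearMap.lTensor_surjective ((cechH x d).obj (ModuleCat.of T T))
    (g := S.g.hom) hS.moduleCat_surjective_g t
  obtain ⟨y, hy⟩ := (cechH_exact₂ x hS d _).1 ((cechTensor_naturality S.g.hom t).symm.trans ht)
  obtain ⟨b, w, hw, hv⟩ := h y ε hε
  refine ⟨b, ?_, hv⟩
  have h1 : b • t = S.f.hom.lTensor _ w := by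
    apply cechTensor_injective_of_projective hP
    rw [map_smul, cechTensor_naturality, hw, map_smul]
    exact congrArg (b • ·) hy.symm
  rw [← map_smul, h1]
  exact (lTensor_exact _ hex hS.moduleCat_surjective_g _).2 ⟨w, rfl⟩

/-- The connecting map sits between `H^i(P)` and `H^j(P)`, both almost zero. -/
lemma sameAlmostIsoClass_cechH_shift {S : ShortComplex (ModuleCat.{u} T)} (hS : S.ShortExact)
    (hP : Module.Projective T S.X₂) {i j : ℤ} (h : i + 1 = j) (hi : i ≠ d) (hj : j ≠ d) :
    SameAlmostIsoClass v ((cechH x i).obj S.X₃) ((cechH x j).obj S.X₁) :=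
  .of_isAlmostIso (hT i hi) (cechδ x hS i j h).hom
    ⟨isAlmostZero_ker_of_exact (f := ((cechH x i).map S.g).hom) (cechH_exact₃ x hS i j h)
      (isAlmostZero_cechH_of_projective hT hP hi),
    isAlmostZero_coker_of_exact (g := ((cechH x j).map S.f).hom) (cechH_exact₁ x hS i j h)
      (isAlmostZero_cechH_of_projective hT hP hj)⟩

/-- If `0 → K → P → M → 0` is exact with `P` projective, then `H^{d-1}(M)` is almost the kernel of
`H^d(T) ⊗ K → H^d(T) ⊗ P`. -/
lemma sameAlmostIsoClass_cechH_ker_lTensor {S : ShortComplex (ModuleCat.{u} T)}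
    (hS : S.ShortExact) (hP : Module.Projective T S.X₂) {i : ℤ} (h : i + 1 = d) :
    SameAlmostIsoClass v ((cechH x i).obj S.X₃) (ModuleCat.of T (LinearMap.ker
      (S.f.hom.lTensor ((cechH x d).obj (ModuleCat.of T T))))) := by
  have hi : i ≠ d := by omega
  let f : (cechH x d).obj S.X₁ →ₗ[T] (cechH x d).obj S.X₂ := ((cechH x d).map S.f).hom
  have hδ : Function.Exact (cechδ x hS i d h).hom f := cechH_exact₁ x hS i d h
  -- The intermediate module is the kernel of `H^d(K) → H^d(P)`, onto which the connecting map
  -- surjects.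
  refine SameAlmostIsoClass.trans (N := ModuleCat.of T (LinearMap.ker f)) ?_
    (SameAlmostIsoClass.symm ?_)
  · refine .of_isAlmostIso (hT i hi) (LinearMap.codRestrict (LinearMap.ker f)
      (cechδ x hS i d h).hom fun y => LinearMap.mem_ker.2 (hδ.apply_apply_eq_zero y)) ⟨?_, ?_⟩
    · rw [LinearMap.ker_codRestrict]
      exact isAlmostZero_ker_of_exact (f := ((cechH x i).map S.g).hom) (cechH_exact₃ x hS i d h)
        (isAlmostZero_cechH_of_projective hT hP hi)
    · rw [LinearMap.range_eq_top.2]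
      · exact (hT i hi).of_subsingleton
      · rintro ⟨z, hz⟩
        obtain ⟨y, rfl⟩ := (hδ z).1 hz
        exact ⟨y, rfl⟩
  -- The comparison map is an almost isomorphism for `K` and injective for `P`, so it induces an
  -- almost isomorphism on kernels.
  · have hK := isAlmostIso_cechTensor hT S.X₁
    have hmem (t) : f (cechTensor x d S.X₁ t) = cechTensor x d S.X₂ (S.f.hom.lTensor _ t) :=
      (cechTensor_naturality S.f.hom t).symm
    refine .of_isAlmostIso (hT i hi) ((cechTensor x d S.X₁).restrict
      (p := LinearMap.ker (S.f.hom.lTensor _)) (q := LinearMap.ker f) fun t ht => ?_) ⟨?_, ?_⟩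
    · rw [LinearMap.mem_ker, hmem, LinearMap.mem_ker.1 ht, map_zero]
    · have h1 := hK.1
      rw [isAlmostZero_ker_iff] at h1 ⊢
      rintro ⟨t, ht⟩ ht' ε hε
      obtain ⟨b, hb, hv⟩ := h1 t (congrArg Subtype.val ht') ε hε
      exact ⟨b, Subtype.ext hb, hv⟩
    · have h1 := hK.2
      rw [isAlmostZero_coker_iff] at h1 ⊢
      rintro ⟨y, hy⟩ ε hε
      obtain ⟨b, t, ht, hv⟩ := h1 y ε hε
      refine ⟨b, ⟨t, ?_⟩, Subtype.ext ht, hv⟩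
      apply cechTensor_injective_of_projective hP
      rw [← hmem, ht, map_smul, LinearMap.mem_ker.1 hy, smul_zero, map_zero]

end AlmostCech

/-! ### Tor through the syzygies of a projective resolution -/

section Syzygy

variable {T : Type u} [CommRing T]

/-- The homology of `X₁ → X₂ → X₃` is the kernel of the map induced on the cokernel `Q` of
`X₁ → X₂`. -/
lemma ShortComplex.nonempty_homology_iso_ker (S : ShortComplex (ModuleCat.{u} T)) {Q : Type u}
    [AddCommGroup Q] [Module T Q] (p : S.X₂ →ₗ[T] Q) (hp : Function.Surjective p)
    (hex : Function.Exact S.f p) (g : Q →ₗ[T] S.X₃) (hg : g ∘ₗ p = S.g.hom) :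
    Nonempty (S.homology ≅ ModuleCat.of T (LinearMap.ker g)) := by
  have hg' (y) : g (p y) = S.g.hom y := LinearMap.congr_fun hg y
  let q : LinearMap.ker S.g.hom →ₗ[T] LinearMap.ker g := p.restrict fun y hy => by
    rw [LinearMap.mem_ker, hg', hy]
  have hq : Function.Surjective q := by
    rintro ⟨z, hz⟩
    obtain ⟨y, rfl⟩ := hp z
    exact ⟨⟨y, by rwa [LinearMap.mem_ker, ← hg']⟩, rfl⟩
  have hker : LinearMap.range S.moduleCatToCycles = LinearMap.ker q := by
    ext ⟨y, hy⟩
    rw [LinearMap.mem_ker, LinearMap.mem_range]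
    constructor
    · rintro ⟨w, hw⟩
      exact Subtype.ext ((hex y).2 ⟨w, congrArg Subtype.val hw⟩)
    · intro h
      obtain ⟨w, hw⟩ := (hex y).1 (congrArg Subtype.val h)
      exact ⟨w, Subtype.ext hw⟩
  exact ⟨S.moduleCatHomologyIso ≪≫ ((Submodule.quotEquivOfEq _ _ hker).trans
    (q.quotKerEquivOfSurjective hq)).toModuleIso⟩

namespace CategoryTheory.ProjectiveResolution

variable {M : ModuleCat.{u} T} (P : ProjectiveResolution M)

/-- The cokernel of `P_{n+1} → P_n`. -/
noncomputable def syzygy (n : ℕ) : ModuleCat.{u} T :=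
  ModuleCat.of T (P.complex.X n ⧸ LinearMap.range (P.complex.d (n + 1) n).hom)

/-- The projection `P_n → K_n` to the cokernel of `P_{n+1} → P_n`. -/
noncomputable def toSyzygy (n : ℕ) : P.complex.X n →ₗ[T] P.syzygy n :=
  (LinearMap.range (P.complex.d (n + 1) n).hom).mkQ

/-- The map `K_{n+1} → P_n` induced by the differential. -/
noncomputable def syzygyι (n : ℕ) : P.syzygy (n + 1) →ₗ[T] P.complex.X n :=
  (LinearMap.range (P.complex.d (n + 2) (n + 1)).hom).liftQ (P.complex.d (n + 1) n).hom (by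
    rintro _ ⟨w, rfl⟩
    exact congrArg (fun k : P.complex.X (n + 2) ⟶ P.complex.X n => k.hom w)
      (P.complex.d_comp_d (n + 2) (n + 1) n))

lemma syzygyι_toSyzygy (n : ℕ) :
    P.syzygyι n ∘ₗ P.toSyzygy (n + 1) = (P.complex.d (n + 1) n).hom :=
  Submodule.liftQ_mkQ _ _ _

lemma toSyzygy_surjective (n : ℕ) : Function.Surjective (P.toSyzygy n) :=
  Submodule.mkQ_surjective _

lemma exact_d_toSyzygy (n : ℕ) :
    Function.Exact (P.complex.d (n + 1) n).hom (P.toSyzygy n) :=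
  LinearMap.exact_map_mkQ_range _

lemma range_syzygyι (n : ℕ) :
    LinearMap.range (P.syzygyι n) = LinearMap.range (P.complex.d (n + 1) n).hom :=
  Submodule.range_liftQ _ _ _

/-- Exactness of the resolution at `P_{n+1}`: the submodule divided out is the whole kernel of the
differential. -/
lemma syzygyι_injective (n : ℕ) : Function.Injective (P.syzygyι n) :=
  LinearMap.ker_eq_bot.1 (Submodule.ker_liftQ_eq_bot _ _ _
    (P.exact_succ n).moduleCat_range_eq_ker.ge)

lemma exact_syzygyι_toSyzygy (n : ℕ) : Function.Exact (P.syzygyι n) (P.toSyzygy n) := by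
  rw [LinearMap.exact_iff, range_syzygyι]
  exact Submodule.ker_mkQ _

/-- The short complex `K_{n+1} → P_n → K_n`. -/
noncomputable def syzygyShortComplex (n : ℕ) : ShortComplex (ModuleCat.{u} T) :=
  ShortComplex.mk (ModuleCat.ofHom (P.syzygyι n)) (ModuleCat.ofHom (P.toSyzygy n))
    (ModuleCat.hom_ext (P.exact_syzygyι_toSyzygy n).linearMap_comp_eq_zero)

lemma syzygyShortComplex_shortExact (n : ℕ) : (P.syzygyShortComplex n).ShortExact :=
  ModuleCat.shortComplex_shortExact _ (P.exact_syzygyι_toSyzygy n) (P.syzygyι_injective n)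
    (P.toSyzygy_surjective n)

lemma module_projective (n : ℕ) : Module.Projective T (P.complex.X n) :=
  (IsProjective.iff_projective (P.complex.X n)).2 (P.projective n)

lemma nonempty_syzygy_zero_iso : Nonempty (P.syzygy 0 ≅ M) := by
  have h1 : Function.Surjective (P.π.f 0) := (ModuleCat.epi_iff_surjective _).1 inferInstance
  exact ⟨((Submodule.quotEquivOfEq _ _ P.exact₀.moduleCat_range_eq_ker).trans
    ((P.π.f 0).hom.quotKerEquivOfSurjective h1)).toModuleIso⟩

/-- `Tor_{n+1}(A, M)` is the kernel of `A ⊗ K_{n+1} → A ⊗ P_n`. -/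
lemma nonempty_tor_succ_iso (A : ModuleCat.{u} T) (n : ℕ) :
    Nonempty (((Tor (ModuleCat.{u} T) (n + 1)).obj A).obj M ≅
      ModuleCat.of T (LinearMap.ker ((P.syzygyι n).lTensor A))) := by
  let F := (MonoidalCategory.tensoringLeft (ModuleCat.{u} T)).obj A
  let K := (F.mapHomologicalComplex _).obj P.complex
  -- By right exactness `A ⊗ K_{n+1}` is the cokernel of `A ⊗ P_{n+2} → A ⊗ P_{n+1}`.
  obtain ⟨e⟩ := ShortComplex.nonempty_homology_iso_ker (K.sc' (n + 2) (n + 1) n)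
    ((P.toSyzygy (n + 1)).lTensor A) (LinearMap.lTensor_surjective _ (P.toSyzygy_surjective _))
    (lTensor_exact A (P.exact_d_toSyzygy (n + 1)) (P.toSyzygy_surjective _))
    ((P.syzygyι n).lTensor A) ((LinearMap.lTensor_comp (A : Type u) (P.syzygyι n)
      (P.toSyzygy (n + 1))).symm.trans (congrArg (LinearMap.lTensor (A : Type u))
        (P.syzygyι_toSyzygy n)))
  exact ⟨P.isoLeftDerivedObj F (n + 1) ≪≫
    K.homologyIsoSc' (n + 2) (n + 1) n (by simp) (by simp) ≪≫ e⟩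

end CategoryTheory.ProjectiveResolution

end Syzygy

/-! ### Comparison of Tor with Čech cohomology -/

section Main

variable {T : Type u} [CommRing T] {v : ValueMap T} {r : ℕ} {x : Fin r → T} {d : ℤ}

/-- Each shift raises the degree by one and passes from `K_k` to `K_{k+1}`, so `k` must vary in the
induction. After `n` shifts the degree is `d - 1`, where the kernel description applies. -/
lemma sameAlmostIsoClass_cechH_syzygy
    (hT : ∀ i, i ≠ d → IsAlmostZero v ((cechH x i).obj (ModuleCat.of T T)))
    {M : ModuleCat.{u} T} (P : ProjectiveResolution M) (n k : ℕ) :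
    SameAlmostIsoClass v ((cechH x (d - (n + 1 : ℕ))).obj (P.syzygy k))
      (ModuleCat.of T (LinearMap.ker
        ((P.syzygyι (k + n)).lTensor ((cechH x d).obj (ModuleCat.of T T))))) := by
  induction n generalizing k with
  | zero =>
    exact sameAlmostIsoClass_cechH_ker_lTensor hT (P.syzygyShortComplex_shortExact k)
      (P.module_projective k) (by simp)
  | succ n ih =>
    have h := sameAlmostIsoClass_cechH_shift hT (P.syzygyShortComplex_shortExact k)
      (P.module_projective k) (i := d - (n + 1 + 1 : ℕ)) (j := d - (n + 1 : ℕ))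
      (by push_cast; ring) (by push_cast; omega) (by push_cast; omega)
    have e : k + 1 + n = k + (n + 1) := by omega
    exact h.trans (e ▸ ih (k + 1))

/-- `Tor_0` is `A ⊗ M`, and the higher ones embed in `A ⊗ K_{n+1}`. -/
lemma IsAlmostZero.tor {A : ModuleCat.{u} T} (hA : IsAlmostZero v A) (M : ModuleCat.{u} T)
    (n : ℕ) : IsAlmostZero v (((Tor (ModuleCat.{u} T) n).obj A).obj M) := by
  cases n with
  | zero =>
    have e : ((Tor (ModuleCat.{u} T) 0).obj A).obj M ≅ ModuleCat.of T (A ⊗[T] M) :=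
      ((MonoidalCategory.tensoringLeft (ModuleCat.{u} T)).obj A).leftDerivedZeroIsoSelf.app M
    exact (hA.tensor (N := M)).of_injective e.toLinearEquiv.toLinearMap e.toLinearEquiv.injective
  | succ n =>
    let P := ProjectiveResolution.of M
    obtain ⟨e⟩ := P.nonempty_tor_succ_iso A n
    exact (hA.tensor (N := P.syzygy (n + 1))).of_injective
      ((LinearMap.ker ((P.syzygyι n).lTensor A)).subtype ∘ₗ e.toLinearEquiv.toLinearMap)
      (Subtype.val_injective.comp e.toLinearEquiv.injective)

/-- If the Čech cohomology of `T` is almost concentrated in degree `d`, then the Čech cohomology of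
any `M` is almost given by the `Tor` of the top cohomology of `T`. -/
lemma sameAlmostIsoClass_tor_cechH
    (hT : ∀ i, i ≠ d → IsAlmostZero v ((cechH x i).obj (ModuleCat.of T T)))
    (M : ModuleCat.{u} T) (n : ℕ) :
    SameAlmostIsoClass v (((Tor (ModuleCat.{u} T) n).obj
      ((cechH x d).obj (ModuleCat.of T T))).obj M) ((cechH x (d - n)).obj M) := by
  -- Any degree other than `d` would do: an almost zero module is needed for isomorphisms to be
  -- almost isomorphisms.
  have hQ := hT (d + 1) (by omega)
  set A := (cechH x d).obj (ModuleCat.of T T)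
  cases n with
  | zero =>
    let F := (MonoidalCategory.tensoringLeft (ModuleCat.{u} T)).obj A
    have e : ((Tor (ModuleCat.{u} T) 0).obj A).obj M ≅ ModuleCat.of T (A ⊗[T] M) :=
      F.leftDerivedZeroIsoSelf.app M
    have h : SameAlmostIsoClass v (ModuleCat.of T (A ⊗[T] M)) ((cechH x d).obj M) :=
      .of_isAlmostIso hQ (cechTensor x d M) (isAlmostIso_cechTensor hT M)
    rw [Nat.cast_zero, sub_zero]
    exact (SameAlmostIsoClass.of_iso hQ e).trans h
  | succ n =>
    let P := ProjectiveResolution.of M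
    obtain ⟨e⟩ := P.nonempty_tor_succ_iso A n
    obtain ⟨e₀⟩ := P.nonempty_syzygy_zero_iso
    have h := sameAlmostIsoClass_cechH_syzygy hT P n 0
    rw [zero_add] at h
    exact (SameAlmostIsoClass.of_iso hQ e).trans
      (h.symm.trans (.of_iso hQ ((cechH x _).mapIso e₀)))

end Main

/-- Inverting an `x_j` that kills `M` gives zero, so the Čech complex vanishes in degree 1 and `H^0`
is its degree 0 term. -/
lemma isAlmostZero_of_smul_eq_zero {T : Type u} [CommRing T] {v : ValueMap T} {r : ℕ}
    {x : Fin r → T} (M : ModuleCat.{u} T) (hM : ∀ (j : Fin r) (m : M), x j • m = 0)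
    (h : IsAlmostZero v ((cechH x 0).obj M)) : IsAlmostZero v M := by
  have hsub (S : {S : Finset (Fin r) // (S.card : ℤ) = 1}) : Subsingleton (CechLoc x M S.1) := by
    obtain ⟨j, hj⟩ : S.1.Nonempty := Finset.card_pos.1 (by have := S.2; omega)
    refine LocalizedModule.subsingleton_iff.2 fun m => ⟨_, Submonoid.mem_powers _, ?_⟩
    rw [← Finset.prod_erase_mul _ _ hj, mul_smul, hM, smul_zero]
  let K := (cechFunctor x).obj M
  have h1 : Subsingleton (K.X 1) := inferInstanceAs (Subsingleton (CechTerm x M 1))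
  have h0 : IsEmpty {S : Finset (Fin r) // (S.card : ℤ) = -1} := ⟨fun S => by
    have := S.2
    omega⟩
  have h2 : Subsingleton (K.X (-1)) := inferInstanceAs (Subsingleton (CechTerm x M (-1)))
  have hd : K.d 0 1 = 0 := (ModuleCat.isZero_of_subsingleton _).eq_of_tgt _ _
  have hd' : K.d (-1) 0 = 0 := (ModuleCat.isZero_of_subsingleton _).eq_of_src _ _
  let e : K.X 0 ≅ K.homology 0 := (K.iCyclesIso 0 1 (by simp) hd).symm ≪≫
    K.isoHomologyπ (-1) 0 (by simp) hd'
  let f : M →ₗ[T] CechTerm x M 0 := LinearMap.pi fun S => LocalizedModule.mkLinearMap _ M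
  -- Only `S = ∅` contributes in degree 0; there the empty product `1` is inverted.
  have hf : Function.Injective f := fun m m' hmm => by
    have h3 := congrFun hmm ⟨∅, by simp⟩
    obtain ⟨⟨c, k, rfl⟩, hc⟩ := LocalizedModule.mk_eq.1 h3
    have hc' : (1 ^ k : T) • (1 : T) • m = (1 ^ k : T) • (1 : T) • m' := hc
    simpa using hc'
  exact h.of_injective (e.toLinearEquiv.toLinearMap ∘ₗ f) (e.toLinearEquiv.injective.comp hf)

theorem proposition4p9 {R : Type*} [CommRing R] [IsLocalRing R] [IsNoetherianRing R]
    {T : Type u} [CommRing T] [Algebra R T] (v : ValueMap T)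
    (d : ℕ) (hd : ringKrullDim R = d)
    {r : ℕ} (x : Fin r → R)
    (hx : (Ideal.span (Set.range x)).radical = IsLocalRing.maximalIdeal R)
    (hT : IsAlmostCohenMacaulay v x T) :
    (∀ (M : Type u) [AddCommGroup M] [Module T M] (n : ℕ),
      SameAlmostIsoClass v
        (((CategoryTheory.Tor (ModuleCat.{u} T) n).obj (cechLocalCohomology T x T d)).obj
          (ModuleCat.of T M))
        (cechLocalCohomology T x M ((d : ℤ) - n))) ∧
    ¬ IsAlmostZero v (cechLocalCohomology T x T d) := by
  let y : Fin r → T := fun j => algebraMap R T (x j)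
  obtain ⟨hT, hmT⟩ := hT
  have hnat (i : ℕ) (hi : (i : ℤ) ≠ d) :
      IsAlmostZero v ((cechH y i).obj (ModuleCat.of T T)) :=
    hT i (by rw [hd]; exact_mod_cast hi)
  have hint (i : ℤ) (hi : i ≠ d) : IsAlmostZero v ((cechH y i).obj (ModuleCat.of T T)) := by
    rcases lt_or_ge i 0 with h | h
    · have := subsingleton_cechH y i (.inl h) (ModuleCat.of T T)
      exact (hnat (d + 1) (by push_cast; omega)).of_subsingleton
    · lift i to ℕ using h
      exact hnat i hi
  have main (M : ModuleCat.{u} T) (n : ℕ) := sameAlmostIsoClass_tor_cechH hint M n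
  refine ⟨fun M _ _ n => main (ModuleCat.of T M) n, fun h => hmT ?_⟩
  let I := (IsLocalRing.maximalIdeal R).map (algebraMap R T)
  let N := ModuleCat.of T (T ⧸ (I • (⊤ : Submodule T T)))
  refine isAlmostZero_of_smul_eq_zero (x := y) N (fun j m => ?_) ?_
  · obtain ⟨m, rfl⟩ := Submodule.Quotient.mk_surjective _ m
    refine (Submodule.Quotient.mk_smul _ _ _).symm.trans ((Submodule.Quotient.mk_eq_zero _).2 ?_)
    refine Submodule.smul_mem_smul (Ideal.mem_map_of_mem _ ?_) trivial
    rw [← hx]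
    exact Ideal.le_radical (Ideal.subset_span ⟨j, rfl⟩)
  -- Taking `n = d` lands in `H^0(T/𝔪T)`.
  · have h1 := main N d
    rw [sub_self] at h1
    exact h1.isAlmostZero_right (IsAlmostZero.tor h N d)
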